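/- Let $\mathbb D=\{z\in\mathbb C:|z|<1\}$ and let $\mu$ be a positive, locally finite (hence $\sigma$-finite) Borel measure on $\mathbb D$. Let $\Lambda_\mu$ be a Poisson point process on $\mathbb D$ with intensity $\mu$, that is, a random (finite or infinite) sequence of points of $\mathbb D$, repetitions allowed, such that for every Borel set $A\subset\mathbb D$ the number $N_A$ of terms of $\Lambda_\mu$ lying in $A$ is a Poisson random variable with parameter $\mu(A)$ (with $N_A=\infty$ almost surely if $\mu(A)=\infty$), and such that $N_A$ and $N_B$ are independent whenever $A,B\subset\mathbb D$ are disjoint Borel sets. For integers $n\ge 0$ and $0\le k<2^n$ put $$A_n=\{z\in\mathbb D: 2^{-(n+1)}<1-|z|\le 2^{-n}\},\qquad T_{n,k}=\Bigl\{z=re^{it}\in A_n: r\ge 0,\ \frac{k}{2^n}\le\frac{t}{2\pi}<\frac{k+1}{2^n}\Bigr\},\qquad \mu_{n,k}=\mu(T_{n,k}).$$ For $0<p<\infty$ let $H^p$ be the space of holomorphic functions $f$ on $\mathbb D$ with $\sup_{0\le r<1}\bigl(\int_0^{2\pi}|f(re^{it})|^p\,\frac{dt}{2\pi}\bigr)^{1/p}<\infty$,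 and let $H^\infty$ be the space of bounded holomorphic functions on $\mathbb D$. A sequence $\Lambda$ in $\mathbb D$ is a zero set for $H^p$ if there is $f\in H^p$, $f\not\equiv 0$, whose zeros in $\mathbb D$, counted with multiplicity, are exactly the terms of $\Lambda$: for every $z\in\mathbb D$ the order of vanishing of $f$ at $z$ equals the number of occurrences of $z$ in $\Lambda$. Then $\sum_{n\ge0}\sum_{k=0}^{2^n-1}2^{-n}\mu_{n,k}=\sum_{n\ge0}2^{-n}\mu(A_n)$, and for every $0<p\le\infty$: - if $\sum_{n,k}2^{-n}\mu_{n,k}<\infty$, then almost surely $\Lambda_\mu$ is a zero set for $H^p$; - if $\sum_{n,k}2^{-n}\mu_{n,k}=\infty$, then almost surely $\Lambda_\mu$ is not a zero set for $H^p$. -/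

import Mathlib

open MeasureTheory ProbabilityTheory
open scoped ENNReal NNReal

noncomputable section

namespace PoissonDisc

/-- The open unit disc, as a type with its subspace topology and Borel `σ`-algebra. -/
abbrev Disc : Type := Metric.ball (0 : ℂ) 1

/-- The dyadic annulus `A_n = {z ∈ 𝔻 : 2^{-(n+1)} < 1 - |z| ≤ 2^{-n}}`. -/
def annulus (n : ℕ) : Set Disc :=
  {z | (2 : ℝ)⁻¹ ^ (n + 1) < 1 - ‖(z : ℂ)‖ ∧ 1 - ‖(z : ℂ)‖ ≤ (2 : ℝ)⁻¹ ^ n}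

/-- The dyadic box `T_{n,k} = {z = r e^{it} ∈ A_n : k/2^n ≤ t/(2π) < (k+1)/2^n}`. -/
def box (n k : ℕ) : Set Disc :=
  {z | z ∈ annulus n ∧ ∃ r t : ℝ, 0 ≤ r ∧ (z : ℂ) = r * Complex.exp (t * Complex.I) ∧
    (k : ℝ) / 2 ^ n ≤ t / (2 * Real.pi) ∧ t / (2 * Real.pi) < ((k : ℝ) + 1) / 2 ^ n}

/-- A finite or infinite sequence of points of the disc, repetitions allowed: its terms are
`pt i` for the natural numbers `i < len`; the values `pt i` with `i ≥ len` are ignored. -/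
structure PointSeq where
  len : ℕ∞
  pt : ℕ → Disc

/-- The number of terms of the sequence that lie in `A` (counted with multiplicity). -/
def PointSeq.count (s : PointSeq) (A : Set Disc) : ℕ∞ :=
  {i : ℕ | (i : ℕ∞) < s.len ∧ s.pt i ∈ A}.encard

/-- The Poisson law with parameter `r ∈ [0, ∞]`; for `r = ∞` it is the unit mass at `∞`. -/
def poissonLaw (r : ℝ≥0∞) : Measure ℕ∞ :=
  if r = ∞ then Measure.dirac ⊤
  else (poissonMeasure r.toNNReal).map (fun k : ℕ => (k : ℕ∞))

/-- The random sequence `S` is a Poisson point process with intensity `μ`: the number of points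
in a Borel set `A` is a Poisson variable with parameter `μ A`, and the numbers of points in two
disjoint Borel sets are independent. -/
structure IsPoissonProcess {Ω : Type*} [MeasurableSpace Ω] (P : Measure Ω)
    (μ : Measure Disc) (S : Ω → PointSeq) : Prop where
  hasLaw_count : ∀ A : Set Disc, MeasurableSet A →
    HasLaw (fun ω => (S ω).count A) (poissonLaw (μ A)) P
  indepFun_count : ∀ A B : Set Disc, MeasurableSet A → MeasurableSet B → Disjoint A B →
    IndepFun (fun ω => (S ω).count A) (fun ω => (S ω).count B) P

/-- The `H^p` (quasi-)norm of a function on the disc, `0 < p ≤ ∞`. -/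
def hardyNorm (p : ℝ≥0∞) (f : ℂ → ℂ) : ℝ≥0∞ :=
  if p = ∞ then ⨆ z ∈ Metric.ball (0 : ℂ) 1, ‖f z‖ₑ
  else ⨆ r ∈ Set.Ico (0 : ℝ) 1,
    (ENNReal.ofReal (2 * Real.pi)⁻¹ * ∫⁻ t in Set.Ioc (0 : ℝ) (2 * Real.pi),
      ‖f (r * Complex.exp (t * Complex.I))‖ₑ ^ p.toReal) ^ (1 / p.toReal)

/-- `f`, restricted to the unit disc, belongs to the Hardy space `H^p`. -/
def MemHardy (p : ℝ≥0∞) (f : ℂ → ℂ) : Prop :=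
  DifferentiableOn ℂ f (Metric.ball (0 : ℂ) 1) ∧ hardyNorm p f < ∞

/-- `s` is a zero set for `H^p`: some `f ∈ H^p`, not identically zero, has at each point `z` of
the disc a zero whose order is the number of occurrences of `z` in `s` (so `f` vanishes at no
other points). -/
def IsZeroSet (p : ℝ≥0∞) (s : PointSeq) : Prop :=
  ∃ f : ℂ → ℂ, MemHardy p f ∧ (∃ z : Disc, f z ≠ 0) ∧
    ∀ z : Disc, analyticOrderAt f (z : ℂ) = s.count {z}

end PoissonDisc

end

namespace PoissonDisc

open Filter Topology

/-! For every `p` the zero sets of `H^p` are exactly the Blaschke sequences, `∑ (1 - |z_i|) < ∞`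
with multiplicity (`isZeroSet_iff_summable`). Necessity is Jensen's formula; for sufficiency the
Blaschke product is bounded by 1, hence lies in every `H^p`.

On `A_n` the quantity `1 - |z|` equals `2^{-n}` up to a factor 2, so the Blaschke condition says `X
= ∑ 2^{-n} N_{A_n} < ∞`. The boxes partition the annuli, so `E X = ∑ 2^{-n} μ(A_n)` is the series of
the theorem.

If `E X` is finite, `X` is finite almost surely. If `E X = ∞`, the second moment method applies: the
`N_{A_n}` are pairwise independent with variance equal to their mean, and the weights are at most 1,
so the variance of a partial sum of `X` is at most its mean; Chebyshev then forces divergence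
(`ae_not_summable_of_variance_le_integral`). Pairwise independence suffices. -/

/-! ### Dyadic annuli and boxes -/

theorem norm_lt_one (z : Disc) : ‖(z : ℂ)‖ < 1 := mem_ball_zero_iff.1 z.2

theorem measurableSet_annulus (n : ℕ) : MeasurableSet (annulus n) := by
  have h : Measurable fun z : Disc => 1 - ‖(z : ℂ)‖ := by fun_prop
  exact (measurableSet_lt measurable_const h).inter (measurableSet_le h measurable_const)

theorem disjoint_annulus {m n : ℕ} (h : m ≠ n) : Disjoint (annulus m) (annulus n) := by
  wlog hmn : m < n generalizing m n
  · exact (this h.symm (lt_of_le_of_ne (not_lt.1 hmn) h.symm)).symm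
  refine Set.disjoint_left.2 fun z hm hn => ?_
  have : (2 : ℝ)⁻¹ ^ n ≤ 2⁻¹ ^ (m + 1) :=
    pow_le_pow_of_le_one (by norm_num) (by norm_num) hmn
  exact absurd (hm.1.trans_le hn.2) (not_lt.2 this)

theorem exists_mem_annulus (z : Disc) : ∃ n, z ∈ annulus n := by
  obtain ⟨n, h1, h2⟩ := exists_nat_pow_near_of_lt_one (sub_pos.2 (norm_lt_one z))
    (sub_le_self 1 (norm_nonneg (z : ℂ))) (y := (2 : ℝ)⁻¹) (by norm_num) (by norm_num)
  exact ⟨n, h1, h2⟩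

/-- The argument of `z` normalized to `[0, 1)`. -/
noncomputable def turn (z : ℂ) : ℝ := if z.arg < 0 then z.arg / (2 * Real.pi) + 1 else z.arg / (2 * Real.pi)

theorem measurable_turn : Measurable turn :=
  Measurable.ite (measurableSet_lt Complex.measurable_arg measurable_const)
    ((Complex.measurable_arg.div_const _).add_const _) (Complex.measurable_arg.div_const _)

theorem turn_mem_Ico (z : ℂ) : turn z ∈ Set.Ico (0 : ℝ) 1 := by
  have h1 := Complex.neg_pi_lt_arg z
  have h2 := Complex.arg_le_pi z
  have hpi := Real.pi_pos
  unfold turn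
  split_ifs with h
  · constructor
    · have : -1 ≤ z.arg / (2 * Real.pi) := by rw [le_div_iff₀ (by positivity)]; linarith
      linarith
    · have : z.arg / (2 * Real.pi) < 0 := div_neg_of_neg_of_pos h (by positivity)
      linarith
  · refine ⟨div_nonneg (not_lt.1 h) (by positivity), ?_⟩
    rw [div_lt_one (by positivity)]
    linarith

theorem norm_mul_exp_turn (z : ℂ) :
    (‖z‖ : ℂ) * Complex.exp ((2 * Real.pi * turn z : ℝ) * Complex.I) = z := by
  have hpi := Real.pi_ne_zero
  unfold turn
  split_ifs with h
  · rw [mul_add, mul_one, mul_div_cancel₀ _ (by positivity)]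
    push_cast
    rw [add_mul, Complex.exp_add, Complex.exp_two_pi_mul_I, mul_one, Complex.norm_mul_exp_arg_mul_I]
  · rw [mul_div_cancel₀ _ (by positivity), Complex.norm_mul_exp_arg_mul_I]

theorem turn_eq {z : ℂ} (hz : z ≠ 0) {r t : ℝ} (hr : 0 ≤ r)
    (h : z = r * Complex.exp (t * Complex.I)) (h0 : 0 ≤ t / (2 * Real.pi))
    (h1 : t / (2 * Real.pi) < 1) : turn z = t / (2 * Real.pi) := by
  have hpi := Real.pi_pos
  have hnorm : ‖z‖ = r := by rw [h]; simp [abs_of_nonneg hr, Complex.norm_exp_ofReal_mul_I]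
  have hr0 : (r : ℂ) ≠ 0 := by rw [← hnorm]; simpa using hz
  have hexp : Complex.exp ((2 * Real.pi * turn z : ℝ) * Complex.I) =
      Complex.exp (t * Complex.I) := by
    refine mul_left_cancel₀ hr0 ?_
    rw [← h, ← hnorm, norm_mul_exp_turn]
  obtain ⟨n, hn⟩ := Complex.exp_eq_exp_iff_exists_int.1 hexp
  have hn' : 2 * Real.pi * turn z = t + n * (2 * Real.pi) := by
    have : ((2 * Real.pi * turn z : ℝ) : ℂ) * Complex.I =
        ((t + n * (2 * Real.pi) : ℝ) : ℂ) * Complex.I := by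
      rw [hn]; push_cast; ring
    exact_mod_cast mul_right_cancel₀ Complex.I_ne_zero this
  have hq : turn z = t / (2 * Real.pi) + n := by
    field_simp
    linarith
  obtain ⟨h2, h3⟩ := turn_mem_Ico z
  -- Two turns in `[0, 1)` that differ by an integer coincide.
  have hn0 : n = 0 := by
    have ha : (n : ℝ) < 1 := by linarith
    have hb : (-1 : ℝ) < n := by linarith
    have ha' : n < 1 := by exact_mod_cast ha
    have hb' : -1 < n := by exact_mod_cast hb
    omega
  simpa [hn0] using hq

theorem ne_zero_of_mem_annulus {n : ℕ} (hn : n ≠ 0) {z : Disc} (hz : z ∈ annulus n) :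
    (z : ℂ) ≠ 0 := by
  intro h
  have := hz.2
  rw [h, norm_zero, sub_zero] at this
  exact absurd this (not_le.2 (pow_lt_one₀ (by norm_num) (by norm_num) hn))

theorem mem_box_iff {n k : ℕ} (hk : k < 2 ^ n) {z : Disc} :
    z ∈ box n k ↔ z ∈ annulus n ∧ (k : ℝ) / 2 ^ n ≤ turn z ∧ turn z < ((k : ℝ) + 1) / 2 ^ n := by
  constructor
  · rintro ⟨hz, r, t, hr, hzr, h1, h2⟩
    refine ⟨hz, ?_⟩
    -- `A_0` contains the origin, whose argument is arbitrary; but the only box at level 0 imposes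
    -- no condition on the turn.
    rcases eq_or_ne n 0 with rfl | hn
    · obtain rfl : k = 0 := by simpa using hk
      simpa using turn_mem_Ico z
    · have hle : ((k : ℝ) + 1) / 2 ^ n ≤ 1 := by
        rw [div_le_one (by positivity)]
        exact_mod_cast hk
      rw [turn_eq (ne_zero_of_mem_annulus hn hz) hr hzr (le_trans (by positivity) h1)
        (h2.trans_le hle)]
      exact ⟨h1, h2⟩
  · rintro ⟨hz, h1, h2⟩
    refine ⟨hz, ‖(z : ℂ)‖, 2 * Real.pi * turn z, norm_nonneg _, (norm_mul_exp_turn z).symm, ?_⟩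
    rw [mul_div_cancel_left₀ _ (by positivity)]
    exact ⟨h1, h2⟩

theorem measurableSet_box {n k : ℕ} (hk : k < 2 ^ n) : MeasurableSet (box n k) := by
  have h : Measurable fun z : Disc => turn z := measurable_turn.comp measurable_subtype_coe
  have : box n k = annulus n ∩ {z | (k : ℝ) / 2 ^ n ≤ turn z ∧ turn z < ((k : ℝ) + 1) / 2 ^ n} :=
    Set.ext fun z => mem_box_iff hk
  rw [this]
  exact (measurableSet_annulus n).inter
    ((measurableSet_le measurable_const h).inter (measurableSet_lt h measurable_const))

/-- A point of `A_n` lies in exactly one box, that of index `⌊2^n turn z⌋`. -/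
theorem sum_measure_box (μ : Measure Disc) (n : ℕ) :
    ∑ k ∈ Finset.range (2 ^ n), μ (box n k) = μ (annulus n) := by
  have hpos : (0 : ℝ) < 2 ^ n := by positivity
  have hfloor {k : ℕ} {z : Disc} (hk : k < 2 ^ n) (hz : z ∈ box n k) :
      ⌊turn z * 2 ^ n⌋₊ = k := by
    obtain ⟨-, h1, h2⟩ := (mem_box_iff hk).1 hz
    rw [div_le_iff₀ hpos] at h1
    rw [lt_div_iff₀ hpos] at h2
    exact (Nat.floor_eq_iff ((Nat.cast_nonneg k).trans h1)).2 ⟨h1, h2⟩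
  rw [← measure_biUnion_finset _ fun k hk => measurableSet_box (Finset.mem_range.1 hk)]
  · congr 1
    ext z
    simp only [Set.mem_iUnion, Finset.mem_range]
    refine ⟨fun ⟨k, _, hz⟩ => hz.1, fun hz => ?_⟩
    obtain ⟨h0, h1⟩ := turn_mem_Ico z
    have h0' : 0 ≤ turn z * 2 ^ n := by positivity
    have hlt : ⌊turn z * 2 ^ n⌋₊ < 2 ^ n := by
      rw [Nat.floor_lt h0']
      push_cast
      nlinarith
    refine ⟨⌊turn z * 2 ^ n⌋₊, hlt, (mem_box_iff hlt).2 ⟨hz, ?_, ?_⟩⟩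
    · rw [div_le_iff₀ hpos]
      exact Nat.floor_le h0'
    · rw [lt_div_iff₀ hpos]
      exact Nat.lt_floor_add_one _
  · intro i hi j hj hij
    refine Set.disjoint_left.2 fun z hzi hzj => hij ?_
    rw [← hfloor (Finset.mem_range.1 hi) hzi, hfloor (Finset.mem_range.1 hj) hzj]

theorem tsum_box_eq_tsum_annulus (μ : Measure Disc) :
    ∑' n : ℕ, ∑ k ∈ Finset.range (2 ^ n), (2 : ℝ≥0∞)⁻¹ ^ n * μ (box n k) =
      ∑' n : ℕ, (2 : ℝ≥0∞)⁻¹ ^ n * μ (annulus n) := by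
  simp only [← Finset.mul_sum, sum_measure_box]

theorem isCompact_setOf_norm_le {r : ℝ} (hr : r < 1) : IsCompact {z : Disc | ‖(z : ℂ)‖ ≤ r} := by
  rw [Subtype.isCompact_iff]
  convert isCompact_closedBall (0 : ℂ) r using 1
  ext z
  simp only [Set.mem_image, Set.mem_ofPred_eq, Subtype.exists, mem_closedBall_zero_iff,
    mem_ball_zero_iff]
  exact ⟨fun ⟨w, _, h, e⟩ => e ▸ h, fun h => ⟨z, h.trans_lt hr, h, rfl⟩⟩

/-- The annulus sits in a compact disc of radius `1 - 2^{-(n+1)}`. This is where local finiteness of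
`μ` enters. -/
theorem measure_annulus_ne_top (μ : Measure Disc) [IsLocallyFiniteMeasure μ] (n : ℕ) :
    μ (annulus n) ≠ ∞ := by
  have h : (1 : ℝ) - 2⁻¹ ^ (n + 1) < 1 := sub_lt_self 1 (by positivity)
  refine ((measure_mono fun z hz => ?_).trans_lt (isCompact_setOf_norm_le h).measure_lt_top).ne
  have := hz.1
  rw [Set.mem_ofPred_eq]
  linarith

theorem tsum_indicator_annulus {n : ℕ} {z : Disc} (hz : z ∈ annulus n) :
    ∑' m : ℕ, (2 : ℝ≥0∞)⁻¹ ^ m * (annulus m).indicator (1 : Disc → ℝ≥0∞) z = 2⁻¹ ^ n := by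
  rw [tsum_eq_single n]
  · simp [hz]
  · intro m hm
    simp [Set.disjoint_right.1 (disjoint_annulus hm) hz]

theorem ofReal_two_inv_pow (n : ℕ) : ENNReal.ofReal ((2 : ℝ)⁻¹ ^ n) = 2⁻¹ ^ n := by
  rw [ENNReal.ofReal_pow (by positivity), ENNReal.ofReal_inv_of_pos two_pos, ENNReal.ofReal_ofNat]

/-! ### Annulus counts and the Blaschke condition -/

namespace PointSeq

/-- The indices of the terms of a sequence. -/
abbrev Index (s : PointSeq) : Type := {i : ℕ // (i : ℕ∞) < s.len}

theorem count_eq_encard (s : PointSeq) (A : Set Disc) :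
    s.count A = {i : s.Index | s.pt i ∈ A}.encard := by
  rw [count, ← Function.Injective.encard_image
    (Subtype.val_injective (p := fun i : ℕ => (i : ℕ∞) < s.len))]
  congr 1
  ext i
  simp [and_comm]

theorem tsum_indicator_eq_count (s : PointSeq) (A : Set Disc) :
    ∑' i : s.Index, A.indicator (1 : Disc → ℝ≥0∞) (s.pt i) = s.count A := by
  rw [count_eq_encard, ← ENNReal.tsum_set_one, tsum_subtype _ fun _ => (1 : ℝ≥0∞)]
  rfl

theorem tsum_annulus_count (s : PointSeq) :
    ∑' n : ℕ, (2 : ℝ≥0∞)⁻¹ ^ n * (s.count (annulus n) : ℝ≥0∞) =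
      ∑' i : s.Index, ∑' m : ℕ,
        (2 : ℝ≥0∞)⁻¹ ^ m * (annulus m).indicator (1 : Disc → ℝ≥0∞) (s.pt i) := by
  rw [ENNReal.tsum_comm]
  simp only [ENNReal.tsum_mul_left, tsum_indicator_eq_count]

/-- A sequence satisfies the Blaschke condition iff the weighted sum of its annulus counts is
finite. -/
theorem summable_one_sub_norm_iff (s : PointSeq) :
    (Summable fun i : s.Index => 1 - ‖(s.pt i : ℂ)‖) ↔
      ∑' n : ℕ, (2 : ℝ≥0∞)⁻¹ ^ n * (s.count (annulus n) : ℝ≥0∞) ≠ ∞ := by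
  rw [tsum_annulus_count]
  have hnn (i : s.Index) : 0 ≤ 1 - ‖(s.pt i : ℂ)‖ := (sub_pos.2 (norm_lt_one _)).le
  constructor
  · intro h
    -- The factor 2 comes from `2^{-n} < 2 (1 - |z|)` on `A_n`.
    refine ne_top_of_le_ne_top (b := 2 * ∑' i : s.Index, ENNReal.ofReal (1 - ‖(s.pt i : ℂ)‖))
      (ENNReal.mul_ne_top (by simp) h.tsum_ofReal_ne_top) ?_
    rw [← ENNReal.tsum_mul_left]
    refine ENNReal.tsum_le_tsum fun i => ?_
    obtain ⟨n, hn⟩ := exists_mem_annulus (s.pt i)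
    rw [tsum_indicator_annulus hn, ← ofReal_two_inv_pow, ← ENNReal.ofReal_ofNat 2,
      ← ENNReal.ofReal_mul zero_le_two]
    refine ENNReal.ofReal_le_ofReal ?_
    have := hn.1
    rw [pow_succ] at this
    linarith
  · intro h
    refine (ENNReal.summable_toReal h).of_nonneg_of_le hnn fun i => ?_
    obtain ⟨n, hn⟩ := exists_mem_annulus (s.pt i)
    rw [tsum_indicator_annulus hn, ← ofReal_two_inv_pow, ENNReal.toReal_ofReal (by positivity)]
    exact hn.2

end PointSeq

/-! ### Blaschke products -/

open ComplexConjugate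

/-- The Blaschke factor with zero `a`, normalized to be positive at `0` when `a ≠ 0`. -/
noncomputable def blaschkeFactor (a z : ℂ) : ℂ :=
  (if a = 0 then -1 else (‖a‖ : ℂ) / a) * ((a - z) / (1 - conj a * z))

theorem one_sub_conj_mul_ne_zero {a z : ℂ} (ha : ‖a‖ < 1) (hz : ‖z‖ < 1) :
    1 - conj a * z ≠ 0 := by
  intro h
  have h1 : ‖conj a * z‖ = 1 := by rw [← sub_eq_zero.1 h, norm_one]
  rw [norm_mul, RCLike.norm_conj] at h1
  nlinarith [norm_nonneg a, norm_nonneg z]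

theorem blaschke_coeff_ne_zero (a : ℂ) : (if a = 0 then -1 else (‖a‖ : ℂ) / a) ≠ 0 := by
  split_ifs with h
  · simp
  · simp [h]

theorem norm_blaschke_coeff (a : ℂ) : ‖(if a = 0 then -1 else (‖a‖ : ℂ) / a)‖ = 1 := by
  split_ifs with h
  · simp
  · simp [h]

theorem norm_blaschkeFactor_le_one {a z : ℂ} (ha : ‖a‖ < 1) (hz : ‖z‖ < 1) :
    ‖blaschkeFactor a z‖ ≤ 1 := by
  rw [blaschkeFactor, norm_mul, norm_blaschke_coeff, one_mul, norm_div]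
  apply div_le_one_of_le₀ _ (norm_nonneg _)
  rw [← sq_le_sq₀ (norm_nonneg _) (norm_nonneg _), Complex.sq_norm, Complex.sq_norm]
  have h1 : Complex.normSq a < 1 := by
    rw [← Complex.sq_norm]; nlinarith [norm_nonneg a]
  have h2 : Complex.normSq z < 1 := by
    rw [← Complex.sq_norm]; nlinarith [norm_nonneg z]
  simp only [Complex.normSq_apply, Complex.sub_re, Complex.sub_im, Complex.mul_re, Complex.mul_im,
    Complex.conj_re, Complex.conj_im, Complex.one_re, Complex.one_im] at *
  -- This is `|1 - āz|² - |a - z|² = (1 - |a|²)(1 - |z|²)`.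
  nlinarith [mul_pos (sub_pos.2 h1) (sub_pos.2 h2)]

theorem blaschkeFactor_eq_zero_iff {a z : ℂ} (ha : ‖a‖ < 1) (hz : ‖z‖ < 1) :
    blaschkeFactor a z = 0 ↔ a = z := by
  rw [blaschkeFactor, mul_eq_zero, or_iff_right (blaschke_coeff_ne_zero a), div_eq_zero_iff,
    or_iff_left (one_sub_conj_mul_ne_zero ha hz), sub_eq_zero]

/-- The bound is uniform on `|z| ≤ r` and linear in `1 - |a|`, so the Blaschke condition makes the
product converge locally uniformly. -/
theorem norm_blaschkeFactor_sub_one_le {a z : ℂ} {r : ℝ} (ha : ‖a‖ < 1) (hz : ‖z‖ ≤ r)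
    (hr : r < 1) : ‖blaschkeFactor a z - 1‖ ≤ (1 - ‖a‖) * (2 / (1 - r)) := by
  have hden := one_sub_conj_mul_ne_zero ha (hz.trans_lt hr)
  by_cases h0 : a = 0
  · subst h0
    have : ‖-(-z) - 1‖ ≤ 1 + 1 := by
      rw [neg_neg]
      exact (norm_sub_le _ _).trans (by simpa using (hz.trans hr.le))
    have h2 : (2 : ℝ) ≤ 2 / (1 - r) := by
      rw [le_div_iff₀ (by linarith)]
      nlinarith [norm_nonneg z]
    simpa [blaschkeFactor] using (by simpa using this : ‖z - 1‖ ≤ 1 + 1).trans (by linarith)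
  · have key : blaschkeFactor a z - 1 =
        -((1 - ‖a‖ : ℝ) : ℂ) * ((a + ‖a‖ * z) / a / (1 - conj a * z)) := by
      have hc : conj a * a = (‖a‖ : ℂ) ^ 2 := Complex.conj_mul' a
      rw [blaschkeFactor, if_neg h0, div_mul_div_comm, sub_eq_iff_eq_add, div_div, ← mul_div_assoc,
        div_add_one (mul_ne_zero h0 hden)]
      congr 1
      push_cast
      linear_combination z * hc
    rw [key, norm_mul, norm_neg, Complex.norm_real, Real.norm_of_nonneg (by linarith)]
    refine mul_le_mul_of_nonneg_left ?_ (by linarith)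
    rw [norm_div]
    refine div_le_div₀ zero_le_two ?_ (by linarith) ?_
    · rw [norm_div, div_le_iff₀ (norm_pos_iff.2 h0)]
      calc ‖a + ‖a‖ * z‖ ≤ ‖a‖ + ‖a‖ * ‖z‖ := by
            refine (norm_add_le _ _).trans ?_
            simp
        _ ≤ 2 * ‖a‖ := by nlinarith [norm_nonneg a]
    · have : ‖(1 : ℂ)‖ - ‖conj a * z‖ ≤ ‖1 - conj a * z‖ := norm_sub_norm_le _ _
      rw [norm_one, norm_mul, RCLike.norm_conj] at this
      nlinarith [norm_nonneg a, norm_nonneg z]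

theorem differentiableOn_blaschkeFactor {a : ℂ} (ha : ‖a‖ < 1) :
    DifferentiableOn ℂ (blaschkeFactor a) (Metric.ball 0 1) := by
  intro z hz
  apply DifferentiableAt.differentiableWithinAt
  unfold blaschkeFactor
  have := one_sub_conj_mul_ne_zero ha (mem_ball_zero_iff.1 hz)
  fun_prop (disch := assumption)

theorem analyticAt_blaschkeFactor {a z : ℂ} (ha : ‖a‖ < 1) (hz : ‖z‖ < 1) :
    AnalyticAt ℂ (blaschkeFactor a) z :=
  (differentiableOn_blaschkeFactor ha).analyticAt
    (Metric.isOpen_ball.mem_nhds (mem_ball_zero_iff.2 hz))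

theorem analyticOrderAt_blaschkeFactor_self {a : ℂ} (ha : ‖a‖ < 1) :
    analyticOrderAt (blaschkeFactor a) a = 1 := by
  have hden := one_sub_conj_mul_ne_zero ha ha
  rw [show (1 : ℕ∞) = ((1 : ℕ) : ℕ∞) from rfl,
    (analyticAt_blaschkeFactor ha ha).analyticOrderAt_eq_natCast]
  refine ⟨fun z => -(if a = 0 then -1 else (‖a‖ : ℂ) / a) / (1 - conj a * z), ?_, ?_, ?_⟩
  · fun_prop (disch := assumption)
  · exact div_ne_zero (neg_ne_zero.2 (blaschke_coeff_ne_zero a)) hden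
  · refine Eventually.of_forall fun z => ?_
    simp only [blaschkeFactor, smul_eq_mul]
    ring

section Product

variable {ι : Type*} {a : ι → ℂ}

theorem summable_norm_blaschkeFactor_sub_one (ha : ∀ i, ‖a i‖ < 1)
    (hs : Summable fun i => 1 - ‖a i‖) {z : ℂ} (hz : ‖z‖ < 1) :
    Summable fun i => ‖blaschkeFactor (a i) z - 1‖ :=
  (hs.mul_right (2 / (1 - ‖z‖))).of_nonneg_of_le (fun _ => norm_nonneg _)
    fun i => norm_blaschkeFactor_sub_one_le (ha i) le_rfl hz

theorem multipliable_blaschkeFactor (ha : ∀ i, ‖a i‖ < 1)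
    (hs : Summable fun i => 1 - ‖a i‖) {z : ℂ} (hz : ‖z‖ < 1) :
    Multipliable fun i => blaschkeFactor (a i) z := by
  simpa using multipliable_one_add_of_summable (summable_norm_blaschkeFactor_sub_one ha hs hz)

theorem tprod_blaschkeFactor_ne_zero (ha : ∀ i, ‖a i‖ < 1)
    (hs : Summable fun i => 1 - ‖a i‖) {z : ℂ} (hz : ‖z‖ < 1) (hne : ∀ i, a i ≠ z) :
    ∏' i, blaschkeFactor (a i) z ≠ 0 := by
  have := tprod_one_add_ne_zero_of_summable (f := fun i => blaschkeFactor (a i) z - 1)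
    (fun i => by simpa [blaschkeFactor_eq_zero_iff (ha i) hz] using hne i)
    (summable_norm_blaschkeFactor_sub_one ha hs hz)
  simpa using this

theorem norm_tprod_blaschkeFactor_le_one (ha : ∀ i, ‖a i‖ < 1)
    (hs : Summable fun i => 1 - ‖a i‖) {z : ℂ} (hz : ‖z‖ < 1) :
    ‖∏' i, blaschkeFactor (a i) z‖ ≤ 1 := by
  refine le_of_tendsto (multipliable_blaschkeFactor ha hs hz).hasProd.norm
    (Eventually.of_forall fun s => ?_)
  exact Finset.prod_le_one (fun _ _ => norm_nonneg _)
    fun i _ => norm_blaschkeFactor_le_one (ha i) hz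

theorem differentiableOn_tprod_blaschkeFactor (ha : ∀ i, ‖a i‖ < 1)
    (hs : Summable fun i => 1 - ‖a i‖) :
    DifferentiableOn ℂ (fun z => ∏' i, blaschkeFactor (a i) z) (Metric.ball 0 1) := by
  intro z hz
  rw [mem_ball_zero_iff] at hz
  obtain ⟨r, hzr, hr⟩ := exists_between hz
  have hsub : Metric.ball (0 : ℂ) r ⊆ Metric.ball 0 1 := Metric.ball_subset_ball hr.le
  have hprod := Summable.hasProdLocallyUniformlyOn_one_add
    (f := fun i z => blaschkeFactor (a i) z - 1) (K := Metric.ball (0 : ℂ) r)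
    Metric.isOpen_ball (hs.mul_right (2 / (1 - r)))
    (Eventually.of_forall fun i x hx =>
      norm_blaschkeFactor_sub_one_le (ha i) (mem_ball_zero_iff.1 hx).le hr)
    (fun i => (((differentiableOn_blaschkeFactor (ha i)).mono hsub).continuousOn.sub
      continuousOn_const))
  simp only [add_sub_cancel] at hprod
  have hd : DifferentiableOn ℂ (fun z => ∏' i, blaschkeFactor (a i) z) (Metric.ball 0 r) := by
    refine TendstoLocallyUniformlyOn.differentiableOn (φ := atTop)
      (hasProdLocallyUniformlyOn_iff_tendstoLocallyUniformlyOn.1 hprod)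
      (Eventually.of_forall fun s => ?_) Metric.isOpen_ball
    exact DifferentiableOn.fun_finsetProd fun i _ =>
      (differentiableOn_blaschkeFactor (ha i)).mono hsub
  exact (hd.differentiableAt
    (Metric.isOpen_ball.mem_nhds (mem_ball_zero_iff.2 hzr))).differentiableWithinAt

/-- Each index over `z` contributes the same positive term `1 - |z|`. -/
theorem finite_fiber_of_summable (hs : Summable fun i => 1 - ‖a i‖) {z : ℂ} (hz : ‖z‖ < 1) :
    {i | a i = z}.Finite := by
  have h := hs.tendsto_cofinite_zero.eventually_lt_const (sub_pos.2 hz)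
  refine (eventually_cofinite.1 h).subset fun i hi => ?_
  simp only [Set.mem_ofPred_eq] at hi ⊢
  simp [hi]

theorem analyticAt_and_analyticOrderAt_prod_blaschkeFactor {z : ℂ} (hz : ‖z‖ < 1) (s : Finset ι)
    (hsz : ∀ i ∈ s, a i = z) :
    AnalyticAt ℂ (fun w => ∏ i ∈ s, blaschkeFactor (a i) w) z ∧
      analyticOrderAt (fun w => ∏ i ∈ s, blaschkeFactor (a i) w) z = s.card := by
  classical
  induction s using Finset.induction_on with
  | empty =>
    refine ⟨by simpa using analyticAt_const, ?_⟩
    rw [AnalyticAt.analyticOrderAt_eq_zero (by simpa using analyticAt_const) |>.2 (by simp)]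
    simp
  | insert i s hi ih =>
    obtain ⟨h1, h2⟩ := ih fun j hj => hsz j (Finset.mem_insert_of_mem hj)
    have hai : a i = z := hsz i (Finset.mem_insert_self i s)
    have h3 := analyticAt_blaschkeFactor (hai ▸ hz : ‖a i‖ < 1) hz
    have h4 : analyticOrderAt (blaschkeFactor (a i)) z = 1 := by
      rw [hai]; exact analyticOrderAt_blaschkeFactor_self hz
    simp only [Finset.prod_insert hi, Finset.card_insert_of_notMem hi]
    refine ⟨h3.mul h1, ?_⟩
    have := analyticOrderAt_mul h3 h1
    rw [h4, h2] at this
    rw [Nat.cast_add, Nat.cast_one, add_comm]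
    exact this

/-- The finitely many factors vanishing at `z` have simple zeros there; the product of the others is
analytic and nonzero at `z`. -/
theorem analyticOrderAt_tprod_blaschkeFactor (ha : ∀ i, ‖a i‖ < 1)
    (hs : Summable fun i => 1 - ‖a i‖) {z : ℂ} (hz : ‖z‖ < 1) :
    analyticOrderAt (fun w => ∏' i, blaschkeFactor (a i) w) z = {i | a i = z}.encard := by
  have hfin := finite_fiber_of_summable hs hz
  set F : Finset ι := hfin.toFinset with hF
  have hmem : Metric.ball (0 : ℂ) 1 ∈ 𝓝 z :=
    Metric.isOpen_ball.mem_nhds (mem_ball_zero_iff.2 hz)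
  have hs' : Summable fun i : {i // i ∉ F} => 1 - ‖a i‖ := hs.subtype _
  have hsplit : (fun w => ∏' i, blaschkeFactor (a i) w) =ᶠ[𝓝 z]
      (fun w => ∏ i ∈ F, blaschkeFactor (a i) w) *
        fun w => ∏' i : {i // i ∉ F}, blaschkeFactor (a i) w := by
    filter_upwards [hmem] with w hw
    rw [mem_ball_zero_iff] at hw
    have h1 := (F.hasProd (fun i => blaschkeFactor (a i) w)).mul_compl
      (multipliable_blaschkeFactor (a := fun i : {i // i ∉ F} => a i)
        (fun i => ha i) hs' hw).hasProd
    exact h1.tprod_eq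
  obtain ⟨h1, h2⟩ := analyticAt_and_analyticOrderAt_prod_blaschkeFactor (a := a) hz F
    fun i hi => by simpa [hF] using hi
  have h3 : AnalyticAt ℂ (fun w => ∏' i : {i // i ∉ F}, blaschkeFactor (a i) w) z :=
    (differentiableOn_tprod_blaschkeFactor (a := fun i : {i // i ∉ F} => a i)
      (fun i => ha i) hs').analyticAt hmem
  rw [analyticOrderAt_congr hsplit, analyticOrderAt_mul h1 h3, h2,
    h3.analyticOrderAt_eq_zero.2, add_zero, hfin.encard_eq_coe_toFinset_card]
  exact tprod_blaschkeFactor_ne_zero (a := fun i : {i // i ∉ F} => a i) (fun i => ha i) hs' hz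
    fun i hi => i.2 (by simpa [hF] using hi)

end Product

/-! ### Jensen's formula and the zeros of Hardy functions -/

/-- If `∫ ‖f‖ ^ q` over the circle of radius `r` is at most `M`, then so is `2πq` times the
average of `log ‖f‖`. -/
theorem circleAverage_log_norm_le {f : ℂ → ℂ} {r q : ℝ} {M : ℝ≥0∞} (hr : 0 ≤ r) (hq : 0 < q)
    (hM : M ≠ ∞) (hf : AnalyticOnNhd ℂ f (Metric.sphere 0 r))
    (hint : ∫⁻ t in Set.Ioc (0 : ℝ) (2 * Real.pi),
      ‖f (r * Complex.exp (t * Complex.I))‖ₑ ^ q ≤ M) :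
    Real.circleAverage (fun z => Real.log ‖f z‖) 0 r ≤ (2 * Real.pi)⁻¹ * (M.toReal / q) := by
  have hsphere : Metric.sphere (0 : ℂ) |r| = Metric.sphere 0 r := by rw [abs_of_nonneg hr]
  have hcont : ContinuousOn (fun z => ‖f z‖ ^ q / q) (Metric.sphere 0 |r|) := by
    rw [hsphere]
    exact (hf.continuousOn.norm.rpow_const fun _ _ => Or.inr hq.le).div_const q
  -- Pointwise `log x ≤ x^q / q`, also at zeros of `f` since `Real.log 0 = 0`.
  refine (Real.circleAverage_mono (f₂ := fun z => ‖f z‖ ^ q / q)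
    (MeromorphicOn.circleIntegrable_log_norm (by rw [hsphere]; exact hf.meromorphicOn))
    hcont.circleIntegrable' fun z _ => Real.log_le_rpow_div (norm_nonneg _) hq).trans ?_
  rw [Real.circleAverage_def, smul_eq_mul]
  refine mul_le_mul_of_nonneg_left ?_ (by positivity)
  rw [intervalIntegral.integral_div, intervalIntegral.integral_of_le (by positivity)]
  refine div_le_div_of_nonneg_right ?_ hq.le
  refine (Real.le_norm_self _).trans ?_
  rw [← toReal_enorm]
  refine ENNReal.toReal_mono hM ((enorm_integral_le_lintegral_enorm _).trans (le_trans ?_ hint))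
  refine lintegral_mono fun t => le_of_eq ?_
  dsimp only
  rw [circleMap_zero, Real.enorm_rpow_of_nonneg (norm_nonneg _) hq.le, enorm_norm]

section Zeros

variable {ι : Type*} {a : ι → ℂ} {f : ℂ → ℂ}

/-- The right side is the zero sum in Jensen's formula. Its terms are nonnegative, and the
multiplicity of each `u` is at least the number of indices in `G` over `u`. -/
theorem sum_log_le_finsum_divisor {r : ℝ}
    (hf : AnalyticOnNhd ℂ f (Metric.closedBall 0 r))
    (htop : ∀ z ∈ Metric.closedBall (0 : ℂ) r, analyticOrderAt f z ≠ ⊤)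
    (hord : ∀ z ∈ Metric.closedBall (0 : ℂ) r, analyticOrderAt f z = {i | a i = z}.encard)
    (G : Finset ι) (hG : ∀ i ∈ G, ‖a i‖ ≤ r) :
    ∑ i ∈ G, Real.log (r * ‖0 - a i‖⁻¹) ≤
      ∑ᶠ u, MeromorphicOn.divisor f (Metric.closedBall 0 r) u * Real.log (r * ‖0 - u‖⁻¹) := by
  classical
  set D := MeromorphicOn.divisor f (Metric.closedBall 0 r) with hD
  have hfin : D.support.Finite := D.finiteSupport (isCompact_closedBall 0 r)
  have hlog {u : ℂ} (hu : ‖u‖ ≤ r) : 0 ≤ Real.log (r * ‖0 - u‖⁻¹) := by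
    -- At the origin the weight is `Real.log 0 = 0`, so zeros there do not contribute.
    rcases eq_or_ne u 0 with rfl | h
    · simp
    · refine Real.log_nonneg ?_
      rw [zero_sub, norm_neg, ← div_eq_mul_inv, one_le_div (norm_pos_iff.2 h)]
      exact hu
  have hcard {u : ℂ} (hu : ‖u‖ ≤ r) (s : Finset ι) (hs : ∀ i ∈ s, a i = u) :
      (s.card : ℤ) ≤ D u := by
    have hmem := mem_closedBall_zero_iff.2 hu
    rw [hD, MeromorphicOn.AnalyticOnNhd.divisor_apply hf hmem]
    have h1 : (s.card : ℕ∞) ≤ analyticOrderAt f u := by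
      rw [hord u hmem, ← Set.encard_coe_eq_coe_finsetCard]
      exact Set.encard_le_encard fun i hi => hs i hi
    obtain ⟨n, hn⟩ := ENat.ne_top_iff_exists.1 (htop u hmem)
    rw [← hn] at h1 ⊢
    have : s.card ≤ n := by exact_mod_cast h1
    simpa using this
  have hDnn (u : ℂ) : 0 ≤ D u := MeromorphicOn.AnalyticOnNhd.divisor_nonneg hf u
  rw [finsum_eq_sum_of_support_subset (s := hfin.toFinset ∪ G.image a),
    Finset.sum_comp (fun u => Real.log (r * ‖0 - u‖⁻¹)) a]
  · refine (Finset.sum_le_sum fun u hu => ?_).trans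
      (Finset.sum_le_sum_of_subset_of_nonneg Finset.subset_union_right fun u hu _ => ?_)
    · obtain ⟨i, hi, rfl⟩ := Finset.mem_image.1 hu
      rw [nsmul_eq_mul]
      refine mul_le_mul_of_nonneg_right ?_ (hlog (hG i hi))
      exact_mod_cast hcard (hG i hi) _ fun j hj => (Finset.mem_filter.1 hj).2
    · by_cases hur : ‖u‖ ≤ r
      · exact mul_nonneg (by exact_mod_cast hDnn u) (hlog hur)
      · have : D u = 0 := D.apply_eq_zero_of_notMem (by simpa using hur)
        simp [this]
  · intro u hu
    have : D u ≠ 0 := fun h => hu (by simp [h])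
    simp [this]

/-- The zeros of a function with bounded integral means satisfy the Blaschke condition. -/
theorem summable_one_sub_norm_of_lintegral_le {q : ℝ} {M : ℝ≥0∞} (hq : 0 < q) (hM : M ≠ ∞)
    (hf : DifferentiableOn ℂ f (Metric.ball 0 1)) (hne : ∃ z ∈ Metric.ball (0 : ℂ) 1, f z ≠ 0)
    (hint : ∀ r ∈ Set.Ico (0 : ℝ) 1, ∫⁻ t in Set.Ioc (0 : ℝ) (2 * Real.pi),
      ‖f (r * Complex.exp (t * Complex.I))‖ₑ ^ q ≤ M)
    (ha : ∀ i, ‖a i‖ < 1)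
    (hord : ∀ z ∈ Metric.ball (0 : ℂ) 1, analyticOrderAt f z = {i | a i = z}.encard) :
    Summable fun i => 1 - ‖a i‖ := by
  classical
  have hfa : AnalyticOnNhd ℂ f (Metric.ball 0 1) := hf.analyticOnNhd Metric.isOpen_ball
  have htop : ∀ z ∈ Metric.ball (0 : ℂ) 1, analyticOrderAt f z ≠ ⊤ := by
    obtain ⟨w, hw, hfw⟩ := hne
    intro z hz
    refine hfa.analyticOrderAt_ne_top_of_isPreconnected
      (convex_ball (0 : ℂ) 1).isPreconnected hw hz ?_
    rw [(hfa w hw).analyticOrderAt_eq_zero.2 hfw]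
    simp
  have h0 : (0 : ℂ) ∈ Metric.ball (0 : ℂ) 1 := by simp
  have hfin0 : {i | a i = 0}.Finite :=
    Set.encard_ne_top_iff.1 (hord 0 h0 ▸ htop 0 h0)
  set n₀ : ℕ := (analyticOrderAt f 0).toNat with hn₀
  -- Jensen's formula also has the terms `n₀ log r` and the log of the trailing coefficient;
  -- restricting to `r ≥ 1/2` makes `-n₀ log r ≤ n₀ log 2`, so `C` does not depend on `r`.
  set C : ℝ := (2 * Real.pi)⁻¹ * (M.toReal / q) + n₀ * Real.log 2 -
    Real.log ‖meromorphicTrailingCoeffAt f 0‖ with hC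
  have hbound {r : ℝ} (hr : r ∈ Set.Ico (2⁻¹ : ℝ) 1) (G : Finset ι) (hG : ∀ i ∈ G, ‖a i‖ ≤ r) :
      ∑ i ∈ G, Real.log (r * ‖0 - a i‖⁻¹) ≤ C := by
    have hr0 : 0 < r := lt_of_lt_of_le (by norm_num) hr.1
    have hsub : Metric.closedBall (0 : ℂ) r ⊆ Metric.ball 0 1 :=
      Metric.closedBall_subset_ball hr.2
    have hfr := hfa.mono hsub
    have h1 := sum_log_le_finsum_divisor hfr (fun z hz => htop z (hsub hz))
      (fun z hz => hord z (hsub hz)) G hG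
    have h2 := MeromorphicOn.circleAverage_log_norm (c := 0) (f := f) hr0.ne'
      (by rw [abs_of_pos hr0]; exact hfr.meromorphicOn)
    rw [abs_of_pos hr0] at h2
    have h3 := circleAverage_log_norm_le hr0.le hq hM (hfr.mono Metric.sphere_subset_closedBall)
      (hint r ⟨hr0.le, hr.2⟩)
    have h4 : MeromorphicOn.divisor f (Metric.closedBall 0 r) 0 = (n₀ : ℤ) := by
      rw [MeromorphicOn.AnalyticOnNhd.divisor_apply hfr (by simpa using hr0.le), hn₀]
      obtain ⟨n, hn⟩ := ENat.ne_top_iff_exists.1 (htop 0 h0)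
      rw [← hn]
      simp
    have h5 : -(n₀ * Real.log 2) ≤ n₀ * Real.log r := by
      rw [← mul_neg, ← Real.log_inv]
      exact mul_le_mul_of_nonneg_left (Real.log_le_log (by norm_num) hr.1) (by positivity)
    rw [h4] at h2
    simp only [Int.cast_natCast] at h2
    linarith
  -- Use `1 - |a|/r ≤ log (r/|a|)` for `a ≠ 0` and let `r → 1`.
  have hpartial (G : Finset ι) (hG : ∀ i ∈ G, a i ≠ 0) : ∑ i ∈ G, (1 - ‖a i‖) ≤ C := by
    have hlim : Tendsto (fun r : ℝ => ∑ i ∈ G, (1 - ‖a i‖ / r)) (𝓝[<] 1)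
        (𝓝 (∑ i ∈ G, (1 - ‖a i‖ / 1))) := by
      refine tendsto_finsetSum _ fun i _ => ?_
      exact tendsto_const_nhds.sub (tendsto_const_nhds.div
        (tendsto_id.mono_left nhdsWithin_le_nhds) one_ne_zero)
    simp only [div_one] at hlim
    refine le_of_tendsto hlim ?_
    have hev : ∀ᶠ r : ℝ in 𝓝[<] 1, ∀ i ∈ G, ‖a i‖ < r :=
      (Finset.eventually_all G).2 fun i _ =>
        (lt_mem_nhds (ha i)).filter_mono nhdsWithin_le_nhds
    filter_upwards [hev, self_mem_nhdsWithin,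
      (lt_mem_nhds (show (2⁻¹ : ℝ) < 1 by norm_num)).filter_mono nhdsWithin_le_nhds]
      with r h1 h2 h3
    refine (Finset.sum_le_sum fun i hi => ?_).trans (hbound ⟨h3.le, h2⟩ G fun i hi => (h1 i hi).le)
    have hpos : 0 < ‖a i‖ := norm_pos_iff.2 (hG i hi)
    have hr0 : 0 < r := hpos.trans (h1 i hi)
    have := Real.one_sub_inv_le_log_of_pos (x := r * ‖a i‖⁻¹) (by positivity)
    rw [zero_sub, norm_neg]
    refine le_trans (le_of_eq ?_) this
    rw [mul_inv, inv_inv]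
    ring
  have hsum : Summable fun i => if a i = 0 then 0 else 1 - ‖a i‖ := by
    refine summable_of_sum_le (c := C) (fun i => ?_) fun G => ?_
    · dsimp only [Pi.zero_apply]
      split_ifs
      · rfl
      · exact (sub_pos.2 (ha i)).le
    · rw [Finset.sum_ite, Finset.sum_const_zero, zero_add]
      exact hpartial _ fun i hi => (Finset.mem_filter.1 hi).2
  -- Only finitely many zeros sit at the origin, so restoring their terms is harmless.
  refine hsum.congr_cofinite (eventually_cofinite.2 (hfin0.subset fun i hi => ?_))
  by_contra h
  exact hi (if_neg h)

end Zeros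

/-- A bound on the Hardy norm bounds the integral means of some positive order. -/
theorem MemHardy.exists_lintegral_le {p : ℝ≥0∞} (hp : 0 < p) {f : ℂ → ℂ} (hf : MemHardy p f) :
    ∃ q : ℝ, 0 < q ∧ ∃ M : ℝ≥0∞, M ≠ ∞ ∧ ∀ r ∈ Set.Ico (0 : ℝ) 1,
      ∫⁻ t in Set.Ioc (0 : ℝ) (2 * Real.pi), ‖f (r * Complex.exp (t * Complex.I))‖ₑ ^ q ≤ M := by
  have hfin := hf.2
  unfold hardyNorm at hfin
  split_ifs at hfin with h
  · refine ⟨1, one_pos, _, ENNReal.mul_ne_top hfin.ne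
      (measure_Ioc_lt_top (μ := volume) (a := (0 : ℝ)) (b := 2 * Real.pi)).ne, fun r hr => ?_⟩
    rw [← setLIntegral_const]
    refine lintegral_mono fun t => ?_
    rw [ENNReal.rpow_one]
    refine le_iSup₂_of_le (f := fun z (_ : z ∈ Metric.ball (0 : ℂ) 1) => ‖f z‖ₑ) _ ?_ le_rfl
    rw [mem_ball_zero_iff, norm_mul, Complex.norm_exp_ofReal_mul_I, mul_one, Complex.norm_real,
      Real.norm_of_nonneg hr.1]
    exact hr.2
  · have hq : 0 < p.toReal := ENNReal.toReal_pos hp.ne' h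
    set B := ⨆ r ∈ Set.Ico (0 : ℝ) 1,
      (ENNReal.ofReal (2 * Real.pi)⁻¹ * ∫⁻ t in Set.Ioc (0 : ℝ) (2 * Real.pi),
        ‖f (r * Complex.exp (t * Complex.I))‖ₑ ^ p.toReal) ^ (1 / p.toReal) with hB
    have hc0 : ENNReal.ofReal (2 * Real.pi)⁻¹ ≠ 0 := by
      rw [Ne, ENNReal.ofReal_eq_zero, not_le]; positivity
    refine ⟨p.toReal, hq, B ^ p.toReal / ENNReal.ofReal (2 * Real.pi)⁻¹,
      ENNReal.div_ne_top (ENNReal.rpow_ne_top_of_nonneg hq.le hfin.ne) hc0, fun r hr => ?_⟩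
    rw [ENNReal.le_div_iff_mul_le (Or.inl hc0) (Or.inl ENNReal.ofReal_ne_top), mul_comm]
    have := le_iSup₂ (f := fun r (_ : r ∈ Set.Ico (0 : ℝ) 1) =>
      (ENNReal.ofReal (2 * Real.pi)⁻¹ * ∫⁻ t in Set.Ioc (0 : ℝ) (2 * Real.pi),
        ‖f (r * Complex.exp (t * Complex.I))‖ₑ ^ p.toReal) ^ (1 / p.toReal)) r hr
    rw [← hB, one_div] at this
    exact (ENNReal.rpow_inv_le_iff hq).1 this

/-- A holomorphic function bounded by `1` lies in every Hardy space. -/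
theorem memHardy_of_norm_le_one (p : ℝ≥0∞) {f : ℂ → ℂ}
    (hf : DifferentiableOn ℂ f (Metric.ball 0 1)) (hb : ∀ z ∈ Metric.ball (0 : ℂ) 1, ‖f z‖ ≤ 1) :
    MemHardy p f := by
  refine ⟨hf, lt_of_le_of_lt ?_ ENNReal.one_lt_top⟩
  have hb' : ∀ z ∈ Metric.ball (0 : ℂ) 1, ‖f z‖ₑ ≤ 1 := fun z hz => by
    rw [← ofReal_norm]
    exact ENNReal.ofReal_le_one.2 (hb z hz)
  unfold hardyNorm
  split_ifs with h
  · exact iSup₂_le hb'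
  · refine iSup₂_le fun r hr => ENNReal.rpow_le_one ?_ (by positivity)
    calc _ ≤ ENNReal.ofReal (2 * Real.pi)⁻¹ * ∫⁻ _ in Set.Ioc (0 : ℝ) (2 * Real.pi), 1 := by
          gcongr with t
          refine ENNReal.rpow_le_one (hb' _ ?_) ENNReal.toReal_nonneg
          rw [mem_ball_zero_iff, norm_mul, Complex.norm_exp_ofReal_mul_I, mul_one,
            Complex.norm_real, Real.norm_of_nonneg hr.1]
          exact hr.2
      _ = 1 := by
          rw [setLIntegral_const, Real.volume_Ioc, sub_zero, one_mul, ← ENNReal.ofReal_mul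
            (by positivity), inv_mul_cancel₀ (by positivity), ENNReal.ofReal_one]

/-! ### Poisson moments and divergence by second moments -/

theorem lintegral_poissonMeasure (r : ℝ≥0) (f : ℕ → ℝ≥0∞) :
    ∫⁻ n, f n ∂(poissonMeasure r) =
      ∑' n : ℕ, ENNReal.ofReal (Real.exp (-r) * r ^ n / n.factorial) * f n := by
  simp [poissonMeasure, lintegral_sum_measure]

/-- The Stein–Chen identity for the Poisson law. -/
theorem lintegral_natCast_mul_poissonMeasure (r : ℝ≥0) (f : ℕ → ℝ≥0∞) :
    ∫⁻ n, n * f n ∂(poissonMeasure r) = r * ∫⁻ n, f (n + 1) ∂(poissonMeasure r) := by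
  rw [lintegral_poissonMeasure, lintegral_poissonMeasure, ← ENNReal.tsum_mul_left,
    tsum_eq_zero_add' ENNReal.summable]
  simp only [Nat.cast_zero, zero_mul, mul_zero, zero_add]
  refine tsum_congr fun n => ?_
  rw [← mul_assoc, ← mul_assoc, ← ENNReal.ofReal_natCast, ← ENNReal.ofReal_coe_nnreal,
    ← ENNReal.ofReal_mul (by positivity), ← ENNReal.ofReal_mul (by positivity)]
  congr 2
  rw [Nat.factorial_succ]
  push_cast
  field_simp
  ring

theorem lintegral_natCast_poissonMeasure (r : ℝ≥0) :
    ∫⁻ n, (n : ℝ≥0∞) ∂(poissonMeasure r) = r := by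
  simpa using lintegral_natCast_mul_poissonMeasure r 1

theorem lintegral_natCast_sq_poissonMeasure (r : ℝ≥0) :
    ∫⁻ n, (n : ℝ≥0∞) ^ 2 ∂(poissonMeasure r) = r * (r + 1) := by
  have := lintegral_natCast_mul_poissonMeasure r (fun n => n)
  simp only [← sq, Nat.cast_add, Nat.cast_one] at this
  rw [this, lintegral_add_right _ measurable_const, lintegral_natCast_poissonMeasure]
  simp

theorem lintegral_poissonLaw (r : ℝ≥0∞) : ∫⁻ n, (n : ℝ≥0∞) ∂(poissonLaw r) = r := by
  unfold poissonLaw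
  split_ifs with h
  · simp [h]
  · rw [lintegral_map .of_discrete .of_discrete]
    simp [lintegral_natCast_poissonMeasure, h]

/-- `toNat` sends `⊤` to 0, which loses nothing: for finite `r` the law is carried by the naturals.
-/
theorem memLp_toNat_poissonLaw {r : ℝ≥0∞} (hr : r ≠ ∞) :
    MemLp (fun n : ℕ∞ => (n.toNat : ℝ)) 2 (poissonLaw r) := by
  rw [poissonLaw, if_neg hr, memLp_map_measure_iff .of_discrete .of_discrete]
  rw [memLp_two_iff_integrable_sq .of_discrete]
  refine ⟨.of_discrete, ?_⟩
  have := lintegral_natCast_sq_poissonMeasure r.toNNReal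
  simp only [HasFiniteIntegral, Function.comp_apply, ENat.toNat_natCast, enorm_pow]
  simp only [Real.enorm_natCast, this]
  finiteness

theorem integral_toNat_poissonLaw {r : ℝ≥0∞} (hr : r ≠ ∞) :
    ∫ n : ℕ∞, (n.toNat : ℝ) ∂(poissonLaw r) = r.toReal := by
  rw [poissonLaw, if_neg hr, integral_map .of_discrete .of_discrete,
    integral_eq_lintegral_of_nonneg_ae (.of_forall fun _ => by positivity) .of_discrete]
  simp [lintegral_natCast_poissonMeasure, ENNReal.coe_toNNReal_eq_toReal]

theorem variance_toNat_poissonLaw {r : ℝ≥0∞} (hr : r ≠ ∞) :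
    Var[fun n : ℕ∞ => (n.toNat : ℝ); poissonLaw r] = r.toReal := by
  have : IsProbabilityMeasure (poissonLaw r) := by
    rw [poissonLaw, if_neg hr]
    exact Measure.isProbabilityMeasure_map .of_discrete
  rw [variance_eq_sub (memLp_toNat_poissonLaw hr), integral_toNat_poissonLaw hr, poissonLaw,
    if_neg hr, integral_map .of_discrete .of_discrete,
    integral_eq_lintegral_of_nonneg_ae (.of_forall fun n => by simp) .of_discrete]
  have h (n : ℕ) : ENNReal.ofReal ((n : ℝ) ^ 2) = (n : ℝ≥0∞) ^ 2 := by
    rw [ENNReal.ofReal_pow (by positivity), ENNReal.ofReal_natCast]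
  simp only [Pi.pow_apply, ENat.toNat_natCast, h, lintegral_natCast_sq_poissonMeasure]
  simp only [ENNReal.coe_toNNReal hr, ENNReal.toReal_mul, ENNReal.toReal_add hr ENNReal.one_ne_top,
    ENNReal.toReal_one]
  ring

/-- A sum of nonnegative pairwise independent random variables whose variances are dominated by
their means diverges almost surely as soon as the sum of the means does. -/
theorem ae_not_summable_of_variance_le_integral {Ω : Type*} [MeasurableSpace Ω] {P : Measure Ω}
    [IsProbabilityMeasure P] {X : ℕ → Ω → ℝ} (hX0 : ∀ n ω, 0 ≤ X n ω) (hX : ∀ n, MemLp (X n) 2 P)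
    (hindep : Pairwise fun i j => IndepFun (X i) (X j) P)
    (hvar : ∀ n, Var[X n; P] ≤ P[X n]) (hdiv : ¬ Summable fun n => P[X n]) :
    ∀ᵐ ω ∂P, ¬ Summable fun n => X n ω := by
  set m : ℕ → ℝ := fun N => ∑ n ∈ Finset.range N, P[X n] with hm
  have hmt : Tendsto m atTop atTop :=
    (not_summable_iff_tendsto_nat_atTop_of_nonneg fun n => integral_nonneg (hX0 n)).1 hdiv
  -- Once the mean `m N` is positive and at least `2 K`, staying below `K` is a deviation of at
  -- least `m N / 2`; Chebyshev bounds its probability by `4 / m N → 0`.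
  have hbound (K : ℕ) : P {ω | ∀ N, ∑ n ∈ Finset.range N, X n ω ≤ K} = 0 := by
    have hlim : Tendsto (fun N => ENNReal.ofReal (4 * (m N)⁻¹)) atTop (𝓝 0) := by
      have := ENNReal.tendsto_ofReal ((tendsto_inv_atTop_zero.comp hmt).const_mul 4)
      simpa using this
    refine le_antisymm (ge_of_tendsto hlim ?_) zero_le
    filter_upwards [hmt.eventually_ge_atTop (2 * K), hmt.eventually_gt_atTop 0] with N hN hN0
    have hint : P[∑ n ∈ Finset.range N, X n] = m N := by
      simp only [Finset.sum_apply, hm]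
      exact integral_finsetSum _ fun n _ => (hX n).integrable (by norm_num)
    have hv : Var[∑ n ∈ Finset.range N, X n; P] ≤ m N := by
      rw [IndepFun.variance_sum (fun n _ => hX n) (fun i _ j _ hij => hindep hij)]
      exact Finset.sum_le_sum fun n _ => hvar n
    have hcheb := meas_ge_le_variance_div_sq (μ := P) (X := ∑ n ∈ Finset.range N, X n)
      (memLp_finsetSum' _ fun n _ => hX n) (half_pos hN0)
    refine (measure_mono fun ω hω => ?_).trans (hcheb.trans (ENNReal.ofReal_le_ofReal ?_))
    · have := hω N
      rw [Set.mem_ofPred_eq, hint, Finset.sum_apply, abs_sub_comm]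
      exact le_trans (by linarith) (le_abs_self _)
    · rw [div_le_iff₀ (by positivity)]
      refine hv.trans (le_of_eq ?_)
      field_simp
      norm_num
  have hall : ∀ᵐ ω ∂P, ∀ K : ℕ, ¬ ∀ N, ∑ n ∈ Finset.range N, X n ω ≤ K :=
    ae_all_iff.2 fun K => by simpa [ae_iff] using hbound K
  filter_upwards [hall] with ω hω hsum
  obtain ⟨K, hK⟩ := exists_nat_ge (∑' n, X n ω)
  exact hω K fun N => (hsum.sum_le_tsum _ fun n _ => hX0 n ω).trans hK

/-! ### Zero sets and the almost sure dichotomy -/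

/-- The zero sets of `H^p` are exactly the sequences satisfying the Blaschke condition. -/
theorem isZeroSet_iff_summable {p : ℝ≥0∞} (hp : 0 < p) (s : PointSeq) :
    IsZeroSet p s ↔ Summable fun i : s.Index => 1 - ‖(s.pt i : ℂ)‖ := by
  have hcount (z : Disc) : s.count {z} = {i : s.Index | (s.pt i : ℂ) = z}.encard := by
    rw [s.count_eq_encard]
    simp [Subtype.ext_iff]
  have hlt (i : s.Index) : ‖(s.pt i : ℂ)‖ < 1 := norm_lt_one _
  constructor
  · rintro ⟨f, hf, ⟨w, hw⟩, hord⟩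
    obtain ⟨q, hq, M, hM, hint⟩ := hf.exists_lintegral_le hp
    exact summable_one_sub_norm_of_lintegral_le hq hM hf.1 ⟨w, w.2, hw⟩ hint hlt
      fun z hz => (hord ⟨z, hz⟩).trans (hcount ⟨z, hz⟩)
  · intro hs
    have hord (z : Disc) : analyticOrderAt
        (fun w => ∏' i : s.Index, blaschkeFactor (s.pt i) w) (z : ℂ) = s.count {z} :=
      (analyticOrderAt_tprod_blaschkeFactor hlt hs (norm_lt_one z)).trans (hcount z).symm
    refine ⟨fun z => ∏' i : s.Index, blaschkeFactor (s.pt i) z,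
      memHardy_of_norm_le_one p (differentiableOn_tprod_blaschkeFactor hlt hs)
        fun z hz => norm_tprod_blaschkeFactor_le_one hlt hs (mem_ball_zero_iff.1 hz), ?_, hord⟩
    -- An identically zero product would have infinite order at 0, but that order is the finite
    -- number of terms at 0.
    by_contra! h
    have h0 : (0 : ℂ) ∈ Metric.ball (0 : ℂ) 1 := by simp
    have htop : analyticOrderAt (fun w => ∏' i : s.Index, blaschkeFactor (s.pt i) w) 0 = ⊤ := by
      refine analyticOrderAt_eq_top.2 ?_
      filter_upwards [Metric.isOpen_ball.mem_nhds h0] with z hz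
      exact h ⟨z, hz⟩
    refine (finite_fiber_of_summable hs (norm_zero.trans_lt one_pos)).encard_lt_top.ne ?_
    rw [← analyticOrderAt_tprod_blaschkeFactor hlt hs (norm_zero.trans_lt one_pos), htop]

variable {Ω : Type*} [MeasurableSpace Ω] {P : Measure Ω} {μ : Measure Disc} {S : Ω → PointSeq}

theorem IsPoissonProcess.ae_tsum_ne_top (hS : IsPoissonProcess P μ S)
    (h : ∑' n : ℕ, (2 : ℝ≥0∞)⁻¹ ^ n * μ (annulus n) ≠ ∞) :
    ∀ᵐ ω ∂P, ∑' n : ℕ, (2 : ℝ≥0∞)⁻¹ ^ n * ((S ω).count (annulus n) : ℝ≥0∞) ≠ ∞ := by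
  have hmeas (n : ℕ) : AEMeasurable (fun ω => ((S ω).count (annulus n) : ℝ≥0∞)) P :=
    Measurable.of_discrete.comp_aemeasurable
      (hS.hasLaw_count _ (measurableSet_annulus n)).aemeasurable
  have hint : ∫⁻ ω, ∑' n : ℕ, (2 : ℝ≥0∞)⁻¹ ^ n * ((S ω).count (annulus n) : ℝ≥0∞) ∂P =
      ∑' n : ℕ, (2 : ℝ≥0∞)⁻¹ ^ n * μ (annulus n) := by
    rw [lintegral_tsum fun n => (hmeas n).const_mul _]
    refine tsum_congr fun n => ?_
    rw [lintegral_const_mul'' _ (hmeas n),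
      (hS.hasLaw_count _ (measurableSet_annulus n)).lintegral_comp
        (f := fun k : ℕ∞ => (k : ℝ≥0∞)) .of_discrete, lintegral_poissonLaw]
  filter_upwards [ae_lt_top' (AEMeasurable.tsum fun n => (hmeas n).const_mul _)
    (hint ▸ h)] with ω hω using hω.ne

theorem IsPoissonProcess.ae_tsum_eq_top [IsProbabilityMeasure P] [IsLocallyFiniteMeasure μ]
    (hS : IsPoissonProcess P μ S) (h : ∑' n : ℕ, (2 : ℝ≥0∞)⁻¹ ^ n * μ (annulus n) = ∞) :
    ∀ᵐ ω ∂P, ∑' n : ℕ, (2 : ℝ≥0∞)⁻¹ ^ n * ((S ω).count (annulus n) : ℝ≥0∞) = ∞ := by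
  have hlaw (n : ℕ) := hS.hasLaw_count _ (measurableSet_annulus n)
  have hμ (n : ℕ) := measure_annulus_ne_top μ n
  have hN (n : ℕ) : MemLp (fun ω => (((S ω).count (annulus n)).toNat : ℝ)) 2 P := by
    have := memLp_toNat_poissonLaw (hμ n)
    rw [← (hlaw n).map_eq] at this
    exact this.comp_of_map (hlaw n).aemeasurable
  have hmean (n : ℕ) : ∫ ω, (2 : ℝ)⁻¹ ^ n * (((S ω).count (annulus n)).toNat : ℝ) ∂P =
      (2 : ℝ)⁻¹ ^ n * (μ (annulus n)).toReal := by
    rw [integral_const_mul, ← integral_toNat_poissonLaw (hμ n),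
      ← (hlaw n).integral_comp .of_discrete]
    rfl
  have hvar (n : ℕ) : Var[fun ω => (2 : ℝ)⁻¹ ^ n * (((S ω).count (annulus n)).toNat : ℝ); P] =
      ((2 : ℝ)⁻¹ ^ n) ^ 2 * (μ (annulus n)).toReal := by
    rw [variance_const_mul, ← variance_toNat_poissonLaw (hμ n), ← (hlaw n).map_eq,
      variance_map .of_discrete (hlaw n).aemeasurable]
    rfl
  have hterm (n : ℕ) {x : ℝ≥0∞} (hx : x ≠ ∞) :
      (2 : ℝ≥0∞)⁻¹ ^ n * x = ENNReal.ofReal ((2 : ℝ)⁻¹ ^ n * x.toReal) := by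
    rw [ENNReal.ofReal_mul (by positivity), ENNReal.ofReal_toReal hx,
      ofReal_two_inv_pow]
  have hdiv := ae_not_summable_of_variance_le_integral
    (X := fun n ω => (2 : ℝ)⁻¹ ^ n * (((S ω).count (annulus n)).toNat : ℝ)) (P := P)
    (fun n ω => by positivity) (fun n => (hN n).const_mul _)
    (fun i j hij => (hS.indepFun_count _ _ (measurableSet_annulus i) (measurableSet_annulus j)
      (disjoint_annulus hij)).comp (φ := fun k : ℕ∞ => (2 : ℝ)⁻¹ ^ i * (k.toNat : ℝ))
        (ψ := fun k : ℕ∞ => (2 : ℝ)⁻¹ ^ j * (k.toNat : ℝ)) .of_discrete .of_discrete)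
    (fun n => by
      rw [hvar, hmean]
      refine mul_le_mul_of_nonneg_right ?_ ENNReal.toReal_nonneg
      -- Squaring the weight `2^{-n} ≤ 1` decreases it, so the variance is at most the mean.
      exact pow_le_of_le_one (by positivity) (pow_le_one₀ (by norm_num) (by norm_num)) two_ne_zero)
    (fun hs => by
      simp only [hmean] at hs
      refine hs.tsum_ofReal_ne_top ?_
      rw [← h]
      exact tsum_congr fun n => (hterm n (hμ n)).symm)
  filter_upwards [hdiv] with ω hω
  by_contra hne
  refine hω ((ENNReal.summable_toReal hne).congr fun n => ?_)
  rw [ENNReal.toReal_mul, ENNReal.toReal_pow, ENNReal.toReal_inv, ENNReal.toReal_ofNat]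
  congr 1
  -- For `k = ⊤` both `ENNReal.toReal` and `ENat.toNat` return 0.
  generalize (S ω).count (annulus n) = k
  cases k <;> simp

end PoissonDisc

theorem mainTheorem4 {Ω : Type*} [MeasurableSpace Ω] (P : Measure Ω) [IsProbabilityMeasure P]
    (μ : Measure PoissonDisc.Disc) [IsLocallyFiniteMeasure μ]
    (S : Ω → PoissonDisc.PointSeq) (hS : PoissonDisc.IsPoissonProcess P μ S)
    (p : ℝ≥0∞) (hp : 0 < p) :
    (∑' n : ℕ, ∑ k ∈ Finset.range (2 ^ n), (2 : ℝ≥0∞)⁻¹ ^ n * μ (PoissonDisc.box n k) =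
      ∑' n : ℕ, (2 : ℝ≥0∞)⁻¹ ^ n * μ (PoissonDisc.annulus n)) ∧
    (∑' n : ℕ, ∑ k ∈ Finset.range (2 ^ n), (2 : ℝ≥0∞)⁻¹ ^ n * μ (PoissonDisc.box n k) < ∞ →
      ∀ᵐ ω ∂P, PoissonDisc.IsZeroSet p (S ω)) ∧
    (∑' n : ℕ, ∑ k ∈ Finset.range (2 ^ n), (2 : ℝ≥0∞)⁻¹ ^ n * μ (PoissonDisc.box n k) = ∞ →
      ∀ᵐ ω ∂P, ¬ PoissonDisc.IsZeroSet p (S ω)) := by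
  simp only [PoissonDisc.isZeroSet_iff_summable hp, PoissonDisc.PointSeq.summable_one_sub_norm_iff,
    PoissonDisc.tsum_box_eq_tsum_annulus, not_not]
  exact ⟨trivial, fun h => hS.ae_tsum_ne_top h.ne, hS.ae_tsum_eq_top⟩
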